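/- Rings are associative with $1$, not necessarily commutative. For a ring $A$, let $\mathcal C_A$ be the set of regular elements (non-zero-divisors on both sides) of $A$, and let $\mathfrak n_A$ be the prime radical of $A$ (the intersection of all prime ideals of $A$). A left Ore set of $A$ is a multiplicatively closed subset $S\subseteq A$ with $1\in S$, $0\notin S$ such that $Sa\cap As\neq\emptyset$ for all $a\in A$, $s\in S$; it is a left denominator set if moreover $as=0$ with $a\in A$, $s\in S$ implies $ta=0$ for some $t\in S$. Then $S^{-1}A=\{s^{-1}a\}$ denotes the left localization of $A$ at $S$. The ring $A$ has a left quotient ring if $\mathcal C_A$ is a left Ore set, and then the left quotient ring is $Q(A):=\mathcal C_A^{-1}A$. For a ring $A$ put $\operatorname{gr}A:=\bigoplus_{i\ge 0}\mathfrak n_A^i/\mathfrak n_A^{i+1}$, the associated graded ring of the $\mathfrak n_A$-adic filtration; $A/\mathfrak n_A$ is its component of degree $0$. **Theorem 1.3.** Let $R$ be a ring, $\mathfrak n:=\mathfrak n_R$, and let $\tilde{\mathcal C}$ be the image of $\mathcal C_R$ under $R\to R/\mathfrak n$, viewed also as a subset of $\operatorname{gr}R$. The following statements are equivalent. 1. The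 ring $R$ has a left quotient ring $Q=Q(R)$, and $Q$ is left Noetherian. 2. The set $\tilde{\mathcal C}$ is a left denominator set of the ring $\operatorname{gr}R$, the ring $\tilde{\mathcal C}^{-1}\operatorname{gr}R$ is left Noetherian, $\tilde{\mathcal C}\subseteq\mathcal C_{R/\mathfrak n}$, and $\mathfrak n$ is nilpotent. If these equivalent conditions hold, then the canonical map $\sigma:R\to Q$, $r\mapsto \frac r1$, satisfies $\sigma(\mathfrak n^i)\subseteq\mathfrak n_Q^i$ for all $i\ge 0$, and there is a ring isomorphism $\tilde{\mathcal C}^{-1}\operatorname{gr}R\simeq\operatorname{gr}Q$ that sends $\frac{x+\mathfrak n^{i+1}}{1}$ to $\sigma(x)+\mathfrak n_Q^{i+1}$ for all $i\ge 0$ and $x\in\mathfrak n^i$. In particular, the ring $\operatorname{gr}Q$ is left Noetherian. -/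

import Mathlib

open scoped DirectSum nonZeroDivisors

namespace LeftQuot

universe u

section Ore

variable {R : Type u} [Ring R]

/-- A left Ore set of `R`: a multiplicative set `S` (with `1 ∈ S` and `0 ∉ S`) such that
`S r ∩ R s ≠ ∅` for all `r ∈ R` and `s ∈ S`. -/
structure IsLeftOreSet (S : Submonoid R) : Prop where
  zero_notMem : (0 : R) ∉ S
  ore : ∀ (r : R), ∀ s ∈ S, ∃ t ∈ S, ∃ q : R, t * r = q * s

/-- A left denominator set of `R`: a left Ore set `S` such that `r s = 0` with `r ∈ R`, `s ∈ S`
implies `t r = 0` for some `t ∈ S`. -/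
structure IsLeftDenominatorSet (S : Submonoid R) : Prop extends IsLeftOreSet S where
  reversible : ∀ (r : R), ∀ s ∈ S, r * s = 0 → ∃ t ∈ S, t * r = 0

/-- A left Ore set that consists of regular elements is a left denominator set. -/
theorem IsLeftOreSet.isLeftDenominatorSet {S : Submonoid R} (h : IsLeftOreSet S)
    (hS : S ≤ R⁰) : IsLeftDenominatorSet S where
  toIsLeftOreSet := h
  reversible r s hs hrs := ⟨1, S.one_mem, by rw [one_mul]; exact (hS hs).2 r hrs⟩

/-- Mathlib's construction of the left localization takes as its input a choice of the elements
`t` and `q` in the Ore condition; we make such a choice (the localization does not depend on it). -/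
@[reducible]
noncomputable def IsLeftDenominatorSet.oreSet {S : Submonoid R} (h : IsLeftDenominatorSet S) :
    OreLocalization.OreSet S :=
  Classical.choice <| OreLocalization.nonempty_oreSet_iff.2
    ⟨fun r₁ r₂ s hs => by
      obtain ⟨t, ht, h0⟩ := h.reversible (r₁ - r₂) s s.2 (by rw [sub_mul, hs, sub_self])
      exact ⟨⟨t, ht⟩, by rwa [mul_sub, sub_eq_zero] at h0⟩,
    fun r s => by
      obtain ⟨t, ht, q, hq⟩ := h.ore r s s.2
      exact ⟨q, ⟨t, ht⟩, hq⟩⟩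

/-- The left localization `S⁻¹R` of `R` at a left denominator set `S`. -/
abbrev IsLeftDenominatorSet.Loc {S : Submonoid R} (h : IsLeftDenominatorSet S) : Type u :=
  letI := h.oreSet
  OreLocalization S R

/-- The ring structure of `S⁻¹R`. -/
noncomputable instance IsLeftDenominatorSet.instRingLoc {S : Submonoid R}
    (h : IsLeftDenominatorSet S) : Ring h.Loc :=
  letI := h.oreSet
  inferInstanceAs (Ring (OreLocalization S R))

/-- The canonical homomorphism `R → S⁻¹R`, `r ↦ r / 1`. -/
noncomputable def IsLeftDenominatorSet.toLoc {S : Submonoid R}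
    (h : IsLeftDenominatorSet S) : R →+* h.Loc :=
  letI := h.oreSet
  OreLocalization.numeratorRingHom

variable (R) in
/-- The (classical) left quotient ring `Q(R) = 𝒞⁻¹R`, with `𝒞 = R⁰` the set of regular elements
of `R`, exists if `𝒞` is a left Ore set. -/
abbrev HasLeftQuotientRing : Prop := IsLeftOreSet R⁰

/-- The left quotient ring `Q(R) = 𝒞⁻¹R`. -/
abbrev HasLeftQuotientRing.Q (h : HasLeftQuotientRing R) : Type u :=
  (h.isLeftDenominatorSet le_rfl).Loc

/-- The canonical homomorphism `σ : R → Q(R)`, `r ↦ r / 1`. -/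
noncomputable abbrev HasLeftQuotientRing.σ (h : HasLeftQuotientRing R) : R →+* h.Q :=
  (h.isLeftDenominatorSet le_rfl).toLoc

end Ore

section PrimeRadical

variable (R : Type u) [Ring R]

/-- A prime ideal of a (not necessarily commutative) ring: a proper two-sided ideal `P` such that
`a R b ⊆ P` implies `a ∈ P` or `b ∈ P`. -/
structure IsPrimeIdeal {R : Type u} [Ring R] (P : Ideal R) : Prop where
  isTwoSided : P.IsTwoSided
  ne_top : P ≠ ⊤
  mem_or_mem : ∀ a b : R, (∀ r : R, a * r * b ∈ P) → a ∈ P ∨ b ∈ P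

/-- The prime radical `𝔫` of `R`: the intersection of all prime ideals of `R`. -/
def primeRadical : Ideal R := sInf {P : Ideal R | IsPrimeIdeal P}

instance : (primeRadical R).IsTwoSided :=
  ⟨fun {a} b ha => by
    rw [primeRadical, Submodule.mem_sInf] at ha ⊢
    intro P hP
    have := hP.isTwoSided
    exact Ideal.mul_mem_right b P (ha P hP)⟩

end PrimeRadical

section Graded

variable {R : Type u} [Ring R] (I : Ideal R)

/-- The additive group `I ^ i / I ^ (i + 1)`. -/
def GrPiece (i : ℕ) : Type u := ↥(I ^ i) ⧸ (I ^ (i + 1)).submoduleOf (I ^ i)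

instance (i : ℕ) : AddCommGroup (GrPiece I i) :=
  inferInstanceAs (AddCommGroup (↥(I ^ i) ⧸ (I ^ (i + 1)).submoduleOf (I ^ i)))

variable {I}

/-- The class `x + I ^ (i + 1)` of an element `x` of `I ^ i`. -/
def GrPiece.mk {i : ℕ} (x : R) (hx : x ∈ I ^ i) : GrPiece I i :=
  Submodule.Quotient.mk (⟨x, hx⟩ : ↥(I ^ i))

theorem GrPiece.ind {i : ℕ} {p : GrPiece I i → Prop} (h : ∀ x hx, p (GrPiece.mk x hx))
    (a : GrPiece I i) : p a := by
  obtain ⟨⟨x, hx⟩, rfl⟩ := Submodule.Quotient.mk_surjective _ a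
  exact h x hx

theorem GrPiece.mk_eq_mk {i : ℕ} {x y : R} (hx : x ∈ I ^ i) (hy : y ∈ I ^ i) :
    GrPiece.mk x hx = GrPiece.mk y hy ↔ x - y ∈ I ^ (i + 1) :=
  Submodule.Quotient.eq _

theorem GrPiece.mk_add {i : ℕ} {x y : R} (hx : x ∈ I ^ i) (hy : y ∈ I ^ i) :
    GrPiece.mk x hx + GrPiece.mk y hy = GrPiece.mk (x + y) (add_mem hx hy) := rfl

theorem GrPiece.mk_zero {i : ℕ} : GrPiece.mk (0 : R) (zero_mem (I ^ i)) = 0 := rfl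

theorem mem_pow_zero (r : R) : r ∈ I ^ 0 := by
  rw [Submodule.pow_zero, Ideal.one_eq_top]
  trivial

theorem GrPiece.sigma_ext {i j : ℕ} (h : i = j) {x y : R} (hx : x ∈ I ^ i) (hy : y ∈ I ^ j)
    (hxy : x = y) :
    GradedMonoid.mk (A := GrPiece I) i (GrPiece.mk x hx) =
      GradedMonoid.mk (A := GrPiece I) j (GrPiece.mk y hy) := by
  subst h hxy
  rfl

variable [I.IsTwoSided]

theorem mul_mem_pow_add {i j : ℕ} {x y : R} (hx : x ∈ I ^ i) (hy : y ∈ I ^ j) :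
    x * y ∈ I ^ (i + j) := by
  rw [Ideal.IsTwoSided.pow_add]
  exact Ideal.mul_mem_mul hx hy

/-- The product `(x + I ^ (i + 1)) (y + I ^ (j + 1)) = x y + I ^ (i + j + 1)`. -/
def GrPiece.mul {i j : ℕ} (a : GrPiece I i) (b : GrPiece I j) : GrPiece I (i + j) :=
  Quotient.liftOn₂ a b (fun x y => GrPiece.mk (x.1 * y.1) (mul_mem_pow_add x.2 y.2)) <| by
    rintro ⟨x, hx⟩ ⟨y, hy⟩ ⟨x', hx'⟩ ⟨y', hy'⟩ h h'
    have h1 : x - x' ∈ I ^ (i + 1) := (Submodule.quotientRel_def ((I ^ (i + 1)).submoduleOf (I ^ i))).1 h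
    have h2 : y - y' ∈ I ^ (j + 1) := (Submodule.quotientRel_def ((I ^ (j + 1)).submoduleOf (I ^ j))).1 h'
    refine (GrPiece.mk_eq_mk _ _).2 ?_
    have e : x * y - x' * y' = (x - x') * y + x' * (y - y') := by noncomm_ring
    have k1 := mul_mem_pow_add h1 hy
    have k2 := mul_mem_pow_add hx' h2
    rw [show i + 1 + j = i + j + 1 by omega] at k1
    rw [← add_assoc] at k2
    show x * y - x' * y' ∈ _
    rw [e]
    exact add_mem k1 k2

theorem GrPiece.mk_mul {i j : ℕ} {x y : R} (hx : x ∈ I ^ i) (hy : y ∈ I ^ j) :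
    GrPiece.mul (GrPiece.mk x hx) (GrPiece.mk y hy) =
      GrPiece.mk (x * y) (mul_mem_pow_add hx hy) := rfl

instance : GradedMonoid.GOne (GrPiece I) where
  one := GrPiece.mk 1 (mem_pow_zero 1)

instance : GradedMonoid.GMul (GrPiece I) where
  mul := GrPiece.mul

/-- The multiplication of the associated graded ring on homogeneous elements. -/
instance : DirectSum.GRing (GrPiece I) where
  mul_zero a := by
    induction a using GrPiece.ind with | _ x hx
    exact (GrPiece.mk_eq_mk (mul_mem_pow_add hx (zero_mem _)) (zero_mem _)).2 (by simp)
  zero_mul b := by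
    induction b using GrPiece.ind with | _ x hx
    exact (GrPiece.mk_eq_mk (mul_mem_pow_add (zero_mem _) hx) (zero_mem _)).2 (by simp)
  mul_add a b c := by
    induction a using GrPiece.ind with | _ x hx
    induction b using GrPiece.ind with | _ y hy
    induction c using GrPiece.ind with | _ z hz
    exact (GrPiece.mk_eq_mk (mul_mem_pow_add hx (add_mem hy hz))
      (add_mem (mul_mem_pow_add hx hy) (mul_mem_pow_add hx hz))).2 (by simp [mul_add])
  add_mul a b c := by
    induction a using GrPiece.ind with | _ x hx
    induction b using GrPiece.ind with | _ y hy
    induction c using GrPiece.ind with | _ z hz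
    exact (GrPiece.mk_eq_mk (mul_mem_pow_add (add_mem hx hy) hz)
      (add_mem (mul_mem_pow_add hx hz) (mul_mem_pow_add hy hz))).2 (by simp [add_mul])
  one_mul := by
    rintro ⟨i, a⟩
    induction a using GrPiece.ind with | _ x hx
    exact GrPiece.sigma_ext (zero_add i) _ _ (one_mul x)
  mul_one := by
    rintro ⟨i, a⟩
    induction a using GrPiece.ind with | _ x hx
    exact GrPiece.sigma_ext (add_zero i) _ _ (mul_one x)
  mul_assoc := by
    rintro ⟨i, a⟩ ⟨j, b⟩ ⟨k, c⟩
    induction a using GrPiece.ind with | _ x hx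
    induction b using GrPiece.ind with | _ y hy
    induction c using GrPiece.ind with | _ z hz
    exact GrPiece.sigma_ext (add_assoc i j k) _ _ (mul_assoc x y z)
  natCast n := GrPiece.mk n (mem_pow_zero _)
  natCast_zero := (GrPiece.mk_eq_mk (mem_pow_zero _) (mem_pow_zero _)).2 (by simp)
  natCast_succ n := by
    refine (GrPiece.mk_eq_mk (mem_pow_zero _) (mem_pow_zero _)).2 ?_
    simp
  intCast n := GrPiece.mk n (mem_pow_zero _)
  intCast_ofNat n := by rw [GrPiece.mk_eq_mk]; simp
  intCast_negSucc_ofNat n := by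
    refine (GrPiece.mk_eq_mk (mem_pow_zero _) (neg_mem (mem_pow_zero _))).2 ?_
    simp

variable (I) in
/-- The associated graded ring `R / I ⊕ I / I ^ 2 ⊕ I ^ 2 / I ^ 3 ⊕ ⋯` of the `I`-adic
filtration of `R`. -/
abbrev Gr : Type u := ⨁ i : ℕ, GrPiece I i

variable (I) in
/-- The homogeneous element of degree `i` of the associated graded ring given by the class
`x + I ^ (i + 1)` of `x ∈ I ^ i`. -/
def Gr.cls (i : ℕ) (x : R) (hx : x ∈ I ^ i) : Gr I :=
  DirectSum.of (GrPiece I) i (GrPiece.mk x hx)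

variable (I) in
/-- The embedding of `R / I` in the associated graded ring as its component of degree zero. -/
def Gr.degZero : R ⧸ I →+* Gr I :=
  Ideal.Quotient.lift I
    { toFun := fun r => Gr.cls I 0 r (mem_pow_zero r)
      map_one' := rfl
      map_mul' := fun x y => by
        simp only [Gr.cls]
        rw [DirectSum.of_mul_of]
        rfl
      map_zero' := (DirectSum.of (GrPiece I) 0).map_zero
      map_add' := fun x y => (DirectSum.of (GrPiece I) 0).map_add (GrPiece.mk x (mem_pow_zero x))
        (GrPiece.mk y (mem_pow_zero y)) } <| by
    intro a ha
    show Gr.cls I 0 a _ = 0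
    have : GrPiece.mk a (mem_pow_zero a) = (0 : GrPiece I 0) := by
      rw [← GrPiece.mk_zero, GrPiece.mk_eq_mk, zero_add, Submodule.pow_one]; simpa using ha
    rw [Gr.cls, this, map_zero]

end Graded

section Main

variable (R : Type u) [Ring R]

/-- `𝒞̃ = π(𝒞)`, the image in `R / 𝔫` of the set `𝒞` of regular elements of `R`. -/
def cTilde : Submonoid (R ⧸ primeRadical R) :=
  (R⁰).map (Ideal.Quotient.mk (primeRadical R))

/-- `𝒞̃` as a multiplicative set of `gr R`, where `R / 𝔫` is the component of degree zero. -/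
def cTildeGr : Submonoid (Gr (primeRadical R)) :=
  (cTilde R).map (Gr.degZero (primeRadical R))

end Main

end LeftQuot

/-! Suppose Q is left Noetherian. The extension to Q of a two-sided ideal of R is again two-sided,
so primes of Q contract to primes of R. Since 𝔫_Q is nilpotent, it contracts exactly to 𝔫, and 𝔫_Q^i
= Q𝔫^i (`comap_primeRadical`, `primeRadical_pow_eq_map`). Hence gr R → gr Q inverts 𝒞̃, its kernel
consists of elements killed by 𝒞̃, and common denominators make every element of gr Q a fraction, so
gr Q is the localization (`exists_loc_cTildeGr_ringEquiv`). It is left Noetherian, being a finite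
sum of Noetherian Q-modules 𝔫_Q^i / 𝔫_Q^(i+1).

Conversely, let 𝔫 be nilpotent. The Ore condition in gr R lifts to R by successive approximation
modulo powers of 𝔫. For the chain condition, L ↦ 𝒞̃⁻¹gr(L ∩ R) is strictly monotone from left ideals
of Q to left ideals of 𝒞̃⁻¹gr R: L is recovered by descending induction on the 𝔫-adic degree. -/

namespace LeftQuot

universe u

/-! ### Fractions, saturations and extended left ideals. -/

section Saturation

variable {A : Type u} [Ring A] {S : Submonoid A}

theorem IsLeftDenominatorSet.toLoc_mul_cancel (h : IsLeftDenominatorSet S) {s : A} (hs : s ∈ S) :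
    ∃ v : h.Loc, v * h.toLoc s = 1 ∧ h.toLoc s * v = 1 := by
  let := h.oreSet
  let w : (OreLocalization S A)ˣ := OreLocalization.numeratorUnit ⟨s, hs⟩
  exact ⟨(w⁻¹ : (OreLocalization S A)ˣ), w.inv_mul, w.mul_inv⟩

theorem IsLeftDenominatorSet.exists_mul_eq_toLoc (h : IsLeftDenominatorSet S) (q : h.Loc) :
    ∃ s ∈ S, ∃ a, h.toLoc s * q = h.toLoc a := by
  let := h.oreSet
  induction q using OreLocalization.ind with | _ r s
  exact ⟨s, s.2, r, OreLocalization.mul_cancel⟩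

theorem IsLeftDenominatorSet.toLoc_eq_zero (h : IsLeftDenominatorSet S) (a : A) :
    h.toLoc a = 0 ↔ ∃ u ∈ S, u * a = 0 := by
  let := h.oreSet
  constructor
  · intro h0
    have h1 : (a /ₒ (1 : S) : OreLocalization S A) = 0 /ₒ 1 :=
      Eq.trans h0 OreLocalization.zero_def
    rw [OreLocalization.oreDiv_eq_iff] at h1
    obtain ⟨u, v, h1, h2⟩ := h1
    refine ⟨u, u.2, ?_⟩
    simp only [smul_zero] at h1
    simp only [Submonoid.coe_one, mul_one] at h2
    rw [h2]; exact h1.symm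
  · rintro ⟨u, hu, h0⟩
    obtain ⟨v, hv, -⟩ := h.toLoc_mul_cancel hu
    rw [← one_mul (h.toLoc a), ← hv, mul_assoc, ← map_mul, h0, map_zero, mul_zero]

theorem IsLeftDenominatorSet.toLoc_cancel (h : IsLeftDenominatorSet S) {s : A} (hs : s ∈ S)
    {p q : h.Loc} (e : h.toLoc s * p = h.toLoc s * q) : p = q := by
  obtain ⟨v, hv, -⟩ := h.toLoc_mul_cancel hs
  rw [← one_mul p, ← one_mul q, ← hv, mul_assoc, e, mul_assoc]

theorem IsLeftDenominatorSet.exists_lift (h : IsLeftDenominatorSet S) {B : Type u} [Ring B]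
    (f : A →+* B) (hf : ∀ s ∈ S, IsUnit (f s)) :
    ∃ F : h.Loc →+* B, ∀ a, F (h.toLoc a) = f a := by
  let := h.oreSet
  choose g hg using hf
  let g' : S →* Bˣ :=
    { toFun := fun s => g s s.2
      map_one' := Units.ext (by rw [hg]; simp)
      map_mul' := fun s t => Units.ext (by rw [hg, Units.val_mul, hg, hg]; simp) }
  exact ⟨OreLocalization.universalHom f g' fun s => (hg s s.2).symm,
    fun a => OreLocalization.universalHom_commutes f g' _⟩

/-- Any two elements of `S` have a common left multiple in `S`. -/
def HasCommonLeftMultiples (S : Submonoid A) : Prop :=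
  ∀ s ∈ S, ∀ t ∈ S, ∃ u ∈ S, ∃ r, u * s = r * t

/-- The `S`-saturation of a left ideal. -/
def HasCommonLeftMultiples.saturation (h : HasCommonLeftMultiples S) (N : Ideal A) :
    AddSubmonoid A where
  carrier := {a | ∃ u ∈ S, u * a ∈ N}
  zero_mem' := ⟨1, S.one_mem, by simp⟩
  add_mem' := by
    rintro a b ⟨s, hs, ha⟩ ⟨t, ht, hb⟩
    obtain ⟨u, hu, r, e⟩ := h s hs t ht
    refine ⟨u * s, S.mul_mem hu hs, ?_⟩
    rw [mul_add]
    refine add_mem ?_ ?_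
    · rw [mul_assoc]; exact N.mul_mem_left _ ha
    · rw [e, mul_assoc]; exact N.mul_mem_left _ hb

theorem HasCommonLeftMultiples.mem_saturation (h : HasCommonLeftMultiples S) (N : Ideal A)
    (a : A) : a ∈ h.saturation N ↔ ∃ u ∈ S, u * a ∈ N := Iff.rfl

/-- By the Ore condition two fractions have a common denominator, and a denominator can be moved
past a left factor. The fractions with numerator in N therefore already form a left ideal. -/
theorem IsLeftDenominatorSet.mem_map_toLoc (h : IsLeftDenominatorSet S) (N : Ideal A)
    (q : h.Loc) : q ∈ N.map h.toLoc ↔ ∃ s ∈ S, ∃ a ∈ N, h.toLoc s * q = h.toLoc a := by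
  constructor
  · intro hq
    induction hq using Submodule.span_induction with
    | mem x hx =>
      obtain ⟨a, ha, rfl⟩ := hx
      exact ⟨1, S.one_mem, a, ha, by simp⟩
    | zero => exact ⟨1, S.one_mem, 0, N.zero_mem, by simp⟩
    | add p q _ _ hp hq =>
      obtain ⟨s, hs, a, ha, e⟩ := hp
      obtain ⟨t, ht, b, hb, e'⟩ := hq
      obtain ⟨w, hw, r, hr⟩ := h.ore s t ht
      refine ⟨w * s, S.mul_mem hw hs, w * a + r * b,
        add_mem (N.mul_mem_left _ ha) (N.mul_mem_left _ hb), ?_⟩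
      rw [mul_add, map_add]
      congr 1
      · rw [map_mul, mul_assoc, e, map_mul]
      · rw [hr, map_mul, mul_assoc, e', map_mul]
    | smul c q _ hq =>
      obtain ⟨s, hs, a, ha, e⟩ := hq
      obtain ⟨w, hw, d, hd⟩ := h.exists_mul_eq_toLoc c
      obtain ⟨t, ht, r, hr⟩ := h.ore d s hs
      refine ⟨t * w, S.mul_mem ht hw, r * a, N.mul_mem_left _ ha, ?_⟩
      rw [smul_eq_mul, map_mul, mul_assoc, ← mul_assoc (h.toLoc w), hd, ← mul_assoc, ← map_mul, hr,
        map_mul, mul_assoc, e, map_mul]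
  · rintro ⟨s, hs, a, ha, e⟩
    obtain ⟨v, hv, -⟩ := h.toLoc_mul_cancel hs
    rw [← one_mul q, ← hv, mul_assoc, e]
    exact Ideal.mul_mem_left _ _ (Ideal.mem_map_of_mem _ ha)

theorem IsLeftDenominatorSet.toLoc_mem_map (h : IsLeftDenominatorSet S) (N : Ideal A) (a : A) :
    h.toLoc a ∈ N.map h.toLoc ↔ ∃ u ∈ S, u * a ∈ N := by
  rw [h.mem_map_toLoc]
  constructor
  · rintro ⟨s, hs, b, hb, e⟩
    rw [← map_mul, ← sub_eq_zero, ← map_sub, h.toLoc_eq_zero] at e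
    obtain ⟨u, hu, e⟩ := e
    refine ⟨u * s, S.mul_mem hu hs, ?_⟩
    rw [mul_sub, sub_eq_zero] at e
    rw [mul_assoc, e]
    exact N.mul_mem_left _ hb
  · rintro ⟨u, hu, hN⟩
    exact ⟨u, hu, _, hN, (map_mul _ _ _).symm⟩

end Saturation

/-! ### Nilpotency of the prime radical of a left Noetherian ring. -/

section PrimeRadicalLemmas

variable {R : Type u} [Ring R]

theorem IsPrimeIdeal.le_of_pow_le {P I : Ideal R} (hP : IsPrimeIdeal P) {k : ℕ}
    (h : I ^ k ≤ P) : I ≤ P := by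
  induction k with
  | zero =>
    rw [Submodule.pow_zero, Ideal.one_eq_top, top_le_iff] at h
    exact absurd h hP.ne_top
  | succ k ih =>
    by_contra hI
    obtain ⟨a, ha, haP⟩ := SetLike.not_le_iff_exists.1 hI
    refine hI (ih fun b hb => ?_)
    refine (hP.mem_or_mem b a fun r => ?_).resolve_right haP
    rw [mul_assoc]
    refine h ?_
    rw [Submodule.pow_succ]
    exact Ideal.mul_mem_mul hb (I.mul_mem_left r ha)

theorem le_primeRadical_of_pow_eq_bot {I : Ideal R} {k : ℕ} (h : I ^ k = ⊥) :
    I ≤ primeRadical R :=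
  le_sInf fun _ hP => hP.le_of_pow_le (h ▸ bot_le)

/-- Noetherian induction: a proper two-sided I that is not prime contains a product JK of strictly
larger two-sided ideals. The case I = 0 gives nilpotency. -/
theorem exists_pow_primeRadical_le [IsNoetherianRing R] (I : Ideal R) (hI : I.IsTwoSided) :
    ∃ k, primeRadical R ^ k ≤ I := by
  induction I using IsWellFounded.induction (α := Ideal R) (· > ·) with | _ I ih
  by_cases hp : IsPrimeIdeal I
  · exact ⟨1, by rw [Submodule.pow_one]; exact sInf_le hp⟩
  by_cases ht : I = ⊤
  · exact ⟨0, ht ▸ le_top⟩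
  obtain ⟨a, b, hab, ha, hb⟩ : ∃ a b, (∀ r, a * r * b ∈ I) ∧ a ∉ I ∧ b ∉ I := by
    by_contra hcon
    push Not at hcon
    refine hp ⟨hI, ht, fun a b h => ?_⟩
    by_cases ha : a ∈ I
    · exact .inl ha
    · exact .inr (hcon a b h ha)
  -- J collects the x with xRb ⊆ I, and K the y with JRy ⊆ I; so a ∈ J, b ∈ K and JK ⊆ I.
  let J : Ideal R :=
    { carrier := {x | ∀ r, x * r * b ∈ I}
      zero_mem' := by simp
      add_mem' := fun hx hy r => by rw [add_mul, add_mul]; exact add_mem (hx r) (hy r)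
      smul_mem' := fun c x hx r => by
        rw [smul_eq_mul, mul_assoc, mul_assoc, ← mul_assoc x]; exact I.mul_mem_left _ (hx r) }
  let K : Ideal R :=
    { carrier := {y | ∀ x ∈ J, ∀ r, x * r * y ∈ I}
      zero_mem' := by simp
      add_mem' := fun hx hy x hJ r => by rw [mul_add]; exact add_mem (hx x hJ r) (hy x hJ r)
      smul_mem' := fun c y hy x hJ r => by
        rw [smul_eq_mul, ← mul_assoc, mul_assoc x]; exact hy x hJ _ }
  have hJ : J.IsTwoSided := ⟨fun {x} c hx r => by rw [mul_assoc x c r]; exact hx _⟩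
  have hK : K.IsTwoSided := ⟨fun {y} c hy x hx r => by
    rw [← mul_assoc]; exact hI.mul_mem_of_left _ (hy x hx r)⟩
  have hIJ : I < J := SetLike.lt_iff_le_and_exists.2
    ⟨fun x hx r => by rw [mul_assoc]; exact hI.mul_mem_of_left _ hx, a, hab, ha⟩
  have hIK : I < K := SetLike.lt_iff_le_and_exists.2
    ⟨fun x hx y _ r => I.mul_mem_left _ hx, b, fun x hx => hx, hb⟩
  obtain ⟨k, hk⟩ := ih J hIJ hJ
  obtain ⟨l, hl⟩ := ih K hIK hK
  refine ⟨k + l, ?_⟩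
  rw [Ideal.IsTwoSided.pow_add]
  refine Ideal.mul_le.2 fun x hx y hy => ?_
  have := hl hy x (hk hx) 1
  rwa [mul_one] at this

end PrimeRadicalLemmas

/-! ### The powers of the prime radicals of R and Q. -/

section QuotientRing

variable {R : Type u} [Ring R]

/-- Only right multiplication by s⁻¹ is in question. The left ideals {q | q sⁿ ∈ S⁻¹I} increase with
n, and their stabilization gives closure under s⁻¹. -/
theorem IsLeftDenominatorSet.isTwoSided_map_toLoc {S : Submonoid R}
    (h : IsLeftDenominatorSet S) [IsNoetherianRing h.Loc] (I : Ideal R) [hI : I.IsTwoSided] :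
    (I.map h.toLoc).IsTwoSided := by
  have hr : ∀ q ∈ I.map h.toLoc, ∀ r, q * h.toLoc r ∈ I.map h.toLoc := by
    intro q hq r
    rw [h.mem_map_toLoc] at hq ⊢
    obtain ⟨s, hs, a, ha, e⟩ := hq
    exact ⟨s, hs, a * r, I.mul_mem_right r ha, by rw [← mul_assoc, e, map_mul]⟩
  have hs : ∀ q ∈ I.map h.toLoc, ∀ s ∈ S, ∀ v, v * h.toLoc s = 1 → q * v ∈ I.map h.toLoc := by
    intro q hq s hs v hv
    let J : ℕ →o Ideal h.Loc :=
      { toFun := fun n =>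
          { carrier := {q | q * h.toLoc s ^ n ∈ I.map h.toLoc}
            zero_mem' := by simp
            add_mem' := fun hx hy => by
              simp only [Set.mem_ofPred_eq, add_mul] at *; exact add_mem hx hy
            smul_mem' := fun c x hx => by
              simp only [Set.mem_ofPred_eq, smul_eq_mul, mul_assoc] at *
              exact Ideal.mul_mem_left _ c hx }
        monotone' := monotone_nat_of_le_succ fun n x hx => by
          have := hr _ hx s
          rwa [mul_assoc, ← pow_succ] at this }
    have hJ : ∀ n x, x ∈ J n ↔ x * h.toLoc s ^ n ∈ I.map h.toLoc := fun _ _ => Iff.rfl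
    obtain ⟨n, hn⟩ := monotone_stabilizes_iff_noetherian.2 ‹IsNoetherianRing h.Loc› J
    have hvs : ∀ n, v ^ n * h.toLoc s ^ n = 1 := by
      intro n
      induction n with
      | zero => simp
      | succ n ih => rw [pow_succ, pow_succ', mul_assoc, ← mul_assoc v, hv, one_mul, ih]
    -- With v = s⁻¹, q v^(n+1) lies in J (n+1) = J n, hence q v = q v^(n+1) sⁿ lies in the extended
    -- ideal.
    have h1 : q * v ^ (n + 1) ∈ J (n + 1) := by
      rw [hJ, mul_assoc, hvs, mul_one]; exact hq
    rwa [← hn (n + 1) n.le_succ, hJ, pow_succ', ← mul_assoc, mul_assoc _ (v ^ n), hvs,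
      mul_one] at h1
  refine ⟨fun {q} c hq => ?_⟩
  obtain ⟨s, hsS, a, e⟩ := h.exists_mul_eq_toLoc c
  obtain ⟨v, hv, -⟩ := h.toLoc_mul_cancel hsS
  rw [← one_mul c, ← hv, mul_assoc, e, ← mul_assoc]
  exact hr _ (hs q hq s hsS v hv) a

theorem IsPrimeIdeal.comap_toLoc {S : Submonoid R} (h : IsLeftDenominatorSet S)
    [IsNoetherianRing h.Loc] {P : Ideal h.Loc} (hP : IsPrimeIdeal P) :
    IsPrimeIdeal (P.comap h.toLoc) where
  isTwoSided := ⟨fun {x} y hx => by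
    rw [Ideal.mem_comap] at hx ⊢
    rw [map_mul]
    exact hP.isTwoSided.mul_mem_of_left _ hx⟩
  ne_top := by
    have := hP.ne_top
    rw [Ne, Ideal.eq_top_iff_one] at this ⊢
    rwa [Ideal.mem_comap, map_one]
  mem_or_mem a b hab := by
    -- T is two-sided in R, hence so is its extension. Thus a c = s⁻¹x with x ∈ T for every c in the
    -- localization, and a c b ∈ P follows.
    let T : Ideal R :=
      { carrier := {x | ∀ r, h.toLoc (x * r * b) ∈ P}
        zero_mem' := by simp
        add_mem' := fun hx hy r => by
          rw [add_mul, add_mul, map_add]; exact add_mem (hx r) (hy r)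
        smul_mem' := fun c x hx r => by
          rw [smul_eq_mul, mul_assoc, mul_assoc, ← mul_assoc x, map_mul]
          exact P.mul_mem_left _ (hx r) }
    have hT : T.IsTwoSided := ⟨fun {x} c hx r => by rw [mul_assoc x c r]; exact hx _⟩
    have hT' := h.isTwoSided_map_toLoc T
    refine hP.mem_or_mem _ _ fun c => ?_
    have h1 : h.toLoc a * c ∈ T.map h.toLoc :=
      hT'.mul_mem_of_left _ (Ideal.mem_map_of_mem _ hab)
    obtain ⟨s, hs, x, hx, e⟩ := (h.mem_map_toLoc _ _).1 h1
    obtain ⟨v, hv, -⟩ := h.toLoc_mul_cancel hs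
    rw [← one_mul (h.toLoc a * c), ← hv, mul_assoc v, e, mul_assoc, ← map_mul]
    have := hx 1
    rw [mul_one] at this
    exact P.mul_mem_left _ this

theorem pow_comap_le {A B : Type u} [Ring A] [Ring B] (f : A →+* B) (I : Ideal B) (k : ℕ) :
    (I.comap f) ^ k ≤ (I ^ k).comap f := by
  induction k with
  | zero => rw [Submodule.pow_zero I, Ideal.one_eq_top, Ideal.comap_top]; exact le_top
  | succ k ih =>
    rw [Submodule.pow_succ, Submodule.pow_succ]
    refine Ideal.mul_le.2 fun x hx y hy => ?_
    rw [Ideal.mem_comap, map_mul]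
    exact Ideal.mul_mem_mul (ih hx) hy

theorem HasLeftQuotientRing.σ_injective (hC : HasLeftQuotientRing R) :
    Function.Injective hC.σ := by
  rw [injective_iff_map_eq_zero]
  intro a ha
  obtain ⟨u, hu, h0⟩ := (IsLeftDenominatorSet.toLoc_eq_zero _ a).1 ha
  exact hu.1 a h0

theorem HasLeftQuotientRing.exists_primeRadical_Q_pow_eq_bot (hC : HasLeftQuotientRing R)
    [IsNoetherianRing hC.Q] : ∃ k, primeRadical hC.Q ^ k = ⊥ := by
  obtain ⟨k, hk⟩ := exists_pow_primeRadical_le (⊥ : Ideal hC.Q) inferInstance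
  exact ⟨k, le_bot_iff.1 hk⟩

/-- The contraction of 𝔫_Q is nilpotent, so it lies in every prime of R; conversely, each prime of Q
contracts to a prime, which contains 𝔫. -/
theorem HasLeftQuotientRing.comap_primeRadical (hC : HasLeftQuotientRing R)
    [IsNoetherianRing hC.Q] :
    (primeRadical hC.Q).comap hC.σ = primeRadical R := by
  obtain ⟨k, hk⟩ := hC.exists_primeRadical_Q_pow_eq_bot
  refine le_antisymm (le_primeRadical_of_pow_eq_bot (k := k) ?_) ?_
  · rw [eq_bot_iff]
    refine (pow_comap_le _ _ _).trans ?_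
    rw [hk]
    intro x hx
    exact hC.σ_injective (by simpa using hx)
  · intro x hx
    rw [Ideal.mem_comap, primeRadical, Submodule.mem_sInf]
    intro P hP
    have h : primeRadical R ≤ Ideal.comap hC.σ P := sInf_le (IsPrimeIdeal.comap_toLoc _ hP)
    exact h hx

theorem HasLeftQuotientRing.σ_mem_pow (hC : HasLeftQuotientRing R)
    [IsNoetherianRing hC.Q] {i : ℕ} {x : R} (hx : x ∈ primeRadical R ^ i) :
    hC.σ x ∈ primeRadical hC.Q ^ i := by
  rw [← hC.comap_primeRadical] at hx
  exact pow_comap_le _ _ _ hx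

theorem HasLeftQuotientRing.exists_primeRadical_pow_eq_bot (hC : HasLeftQuotientRing R)
    [IsNoetherianRing hC.Q] : ∃ k, primeRadical R ^ k = ⊥ := by
  obtain ⟨k, hk⟩ := hC.exists_primeRadical_Q_pow_eq_bot
  refine ⟨k, eq_bot_iff.2 fun x hx => hC.σ_injective ?_⟩
  have := hC.σ_mem_pow hx
  rw [hk] at this
  simpa using this

/-- In a product p · s⁻¹a with a ∈ 𝔫, the factor s⁻¹ is absorbed by p, because 𝔫_Q^i is two-sided.
-/
theorem HasLeftQuotientRing.primeRadical_pow_eq_map (hC : HasLeftQuotientRing R)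
    [IsNoetherianRing hC.Q] (i : ℕ) :
    primeRadical hC.Q ^ i = (primeRadical R ^ i).map hC.σ := by
  refine le_antisymm ?_ (Ideal.map_le_iff_le_comap.2 fun x hx => hC.σ_mem_pow hx)
  induction i with
  | zero =>
    rw [Submodule.pow_zero (primeRadical R), Ideal.one_eq_top, Ideal.map_top]; exact le_top
  | succ i ih =>
    rw [Submodule.pow_succ]
    refine Ideal.mul_le.2 fun p hp q hq => ?_
    obtain ⟨s, hs, a, e⟩ := IsLeftDenominatorSet.exists_mul_eq_toLoc _ q
    obtain ⟨v, hv, -⟩ := IsLeftDenominatorSet.toLoc_mul_cancel _ hs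
    have ha : a ∈ primeRadical R := by
      rw [← hC.comap_primeRadical, Ideal.mem_comap, HasLeftQuotientRing.σ, ← e]
      exact Ideal.mul_mem_left _ _ hq
    have hpv := ih (Ideal.mul_mem_right v _ hp)
    obtain ⟨t, ht, b, hb, e'⟩ := (IsLeftDenominatorSet.mem_map_toLoc _ _ _).1 hpv
    refine (IsLeftDenominatorSet.mem_map_toLoc _ _ _).2 ⟨t, ht, b * a, ?_, ?_⟩
    · rw [Submodule.pow_succ]; exact Ideal.mul_mem_mul hb ha
    · rw [map_mul, ← e', ← e]
      simp only [mul_assoc]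
      rw [← mul_assoc v, hv, one_mul]

theorem HasLeftQuotientRing.mem_primeRadical_pow (hC : HasLeftQuotientRing R)
    [IsNoetherianRing hC.Q] {i : ℕ} {q : hC.Q} :
    q ∈ primeRadical hC.Q ^ i ↔ ∃ s ∈ R⁰, ∃ x ∈ primeRadical R ^ i, hC.σ s * q = hC.σ x := by
  rw [primeRadical_pow_eq_map]
  exact IsLeftDenominatorSet.mem_map_toLoc _ _ _

theorem HasLeftQuotientRing.σ_mem_primeRadical_pow (hC : HasLeftQuotientRing R)
    [IsNoetherianRing hC.Q] {i : ℕ} {x : R} :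
    hC.σ x ∈ primeRadical hC.Q ^ i ↔ ∃ u ∈ R⁰, u * x ∈ primeRadical R ^ i := by
  rw [primeRadical_pow_eq_map]
  exact IsLeftDenominatorSet.toLoc_mem_map _ _ _

theorem HasLeftQuotientRing.mem_primeRadical_of_mul_left (hC : HasLeftQuotientRing R)
    [IsNoetherianRing hC.Q] {s x : R} (hs : s ∈ R⁰)
    (h : s * x ∈ primeRadical R) : x ∈ primeRadical R := by
  obtain ⟨v, hv, -⟩ := (hC.isLeftDenominatorSet le_rfl).toLoc_mul_cancel hs
  rw [← hC.comap_primeRadical, Ideal.mem_comap] at h ⊢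
  rw [map_mul] at h
  rw [← one_mul (hC.σ x), ← hv, mul_assoc]
  exact Ideal.mul_mem_left _ _ h

/-- In Q, s can be cancelled on the right inside 𝔫_Q^i. The factor u appears because the contraction
of 𝔫_Q^i is the saturation of 𝔫^i. -/
theorem HasLeftQuotientRing.mem_primeRadical_pow_of_mul_right (hC : HasLeftQuotientRing R)
    [IsNoetherianRing hC.Q] {s x : R} (hs : s ∈ R⁰) {i : ℕ}
    (h : x * s ∈ primeRadical R ^ i) : ∃ u ∈ R⁰, u * x ∈ primeRadical R ^ i := by
  obtain ⟨v, -, hv⟩ := (hC.isLeftDenominatorSet le_rfl).toLoc_mul_cancel hs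
  rw [← hC.σ_mem_primeRadical_pow]
  have := hC.σ_mem_pow h
  rw [map_mul] at this
  rw [← mul_one (hC.σ x), ← hv, ← mul_assoc]
  exact Ideal.mul_mem_right _ _ this

theorem HasLeftQuotientRing.mem_primeRadical_of_mul_right (hC : HasLeftQuotientRing R)
    [IsNoetherianRing hC.Q] {s x : R} (hs : s ∈ R⁰)
    (h : x * s ∈ primeRadical R) : x ∈ primeRadical R := by
  rw [← Submodule.pow_one (primeRadical R)] at h
  obtain ⟨u, hu, h⟩ := hC.mem_primeRadical_pow_of_mul_right hs h
  rw [Submodule.pow_one] at h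
  exact hC.mem_primeRadical_of_mul_left hu h

theorem HasLeftQuotientRing.cTilde_le (hC : HasLeftQuotientRing R)
    [IsNoetherianRing hC.Q] :
    cTilde R ≤ nonZeroDivisors (R ⧸ primeRadical R) := by
  rintro _ ⟨s, hs, rfl⟩
  constructor <;> intro a ha <;> obtain ⟨x, rfl⟩ := Ideal.Quotient.mk_surjective a <;>
    rw [← map_mul, Ideal.Quotient.eq_zero_iff_mem] at ha <;>
    rw [Ideal.Quotient.eq_zero_iff_mem]
  · exact hC.mem_primeRadical_of_mul_left hs ha
  · exact hC.mem_primeRadical_of_mul_right hs ha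

end QuotientRing

/-! ### Homogeneous components and functoriality of the associated graded ring. -/

section AssociatedGraded

variable {A : Type u} [Ring A] {I : Ideal A}

/-- Additive maps on `I ^ i` that vanish on `I ^ (i + 1)` factor through `I ^ i / I ^ (i + 1)`. -/
def GrPiece.lift {M : Type*} [AddCommGroup M] {i : ℕ} (f : ↥(I ^ i) →+ M)
    (hf : ∀ x : ↥(I ^ i), x.1 ∈ I ^ (i + 1) → f x = 0) : GrPiece I i →+ M :=
  QuotientAddGroup.lift ((I ^ (i + 1)).submoduleOf (I ^ i)).toAddSubgroup f fun x hx => hf x hx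

theorem GrPiece.mk_eq_zero {i : ℕ} {x : A} (hx : x ∈ I ^ i) :
    GrPiece.mk x hx = 0 ↔ x ∈ I ^ (i + 1) := by
  rw [← GrPiece.mk_zero, GrPiece.mk_eq_mk, sub_zero]

theorem Gr.cls_add {i : ℕ} {x y : A} (hx : x ∈ I ^ i) (hy : y ∈ I ^ i) :
    Gr.cls I i (x + y) (add_mem hx hy) = Gr.cls I i x hx + Gr.cls I i y hy :=
  (DirectSum.of (GrPiece I) i).map_add (GrPiece.mk x hx) (GrPiece.mk y hy)

theorem Gr.cls_eq_zero {i : ℕ} {x : A} (hx : x ∈ I ^ (i + 1)) (hx' : x ∈ I ^ i) :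
    Gr.cls I i x hx' = 0 := by
  rw [Gr.cls, (GrPiece.mk_eq_zero hx').2 hx, map_zero]

theorem Gr.cls_apply_self {i : ℕ} {x : A} (hx : x ∈ I ^ i) :
    Gr.cls I i x hx i = GrPiece.mk x hx := DirectSum.of_eq_same _ _

theorem Gr.exists_apply_eq_mk (a : Gr I) (i : ℕ) : ∃ x hx, a i = GrPiece.mk x hx := by
  generalize a i = b
  induction b using GrPiece.ind with | _ x hx
  exact ⟨x, hx, rfl⟩

theorem Gr.mem_of_cls_mem (T : AddSubmonoid (Gr I)) (a : Gr I)
    (h : ∀ i x hx, a i = GrPiece.mk x hx → Gr.cls I i x hx ∈ T) : a ∈ T := by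
  classical
  rw [← DirectSum.sum_support_of a]
  refine sum_mem fun i _ => ?_
  obtain ⟨x, hx, e⟩ := Gr.exists_apply_eq_mk a i
  rw [e]
  exact h i x hx e

theorem Gr.induction {p : Gr I → Prop} (a : Gr I) (zero : p 0)
    (cls : ∀ i x hx, p (Gr.cls I i x hx)) (add : ∀ a b, p a → p b → p (a + b)) : p a := by
  induction a using DirectSum.induction_on with
  | zero => exact zero
  | of i b =>
    induction b using GrPiece.ind with | _ x hx
    exact cls i x hx
  | add a b ha hb => exact add a b ha hb

/-- Allows components to be computed on any representative; it serves right multiplication by an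
element of degree zero and the map gr R → gr Q. -/
theorem Gr.apply_eq_mk_map {B : Type u} [Ring B] {J : Ideal B} (F : Gr I →+ Gr J) (f : A →+ B)
    (hf : ∀ i x, x ∈ I ^ i → f x ∈ J ^ i)
    (hF : ∀ i x hx, F (Gr.cls I i x hx) = Gr.cls J i (f x) (hf i x hx))
    (a : Gr I) (i : ℕ) (x : A) (hx : x ∈ I ^ i) (e : a i = GrPiece.mk x hx) :
    F a i = GrPiece.mk (f x) (hf i x hx) := by
  induction a using Gr.induction generalizing x with
  | zero =>
    have h := (GrPiece.mk_eq_zero hx).1 e.symm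
    rw [map_zero, (GrPiece.mk_eq_zero (hf i x hx)).2 (hf _ x h)]
    rfl
  | cls j y hy =>
    rw [hF]
    by_cases hij : i = j
    · subst hij
      rw [Gr.cls_apply_self, GrPiece.mk_eq_mk] at *
      rw [← map_sub]
      exact hf _ _ e
    · rw [Gr.cls, DirectSum.of_eq_of_ne _ _ _ hij] at e
      have h := (GrPiece.mk_eq_zero hx).1 e.symm
      rw [Gr.cls, DirectSum.of_eq_of_ne _ _ _ hij, (GrPiece.mk_eq_zero (hf i x hx)).2 (hf _ x h)]
  | add a b ha hb =>
    obtain ⟨y, hy, ey⟩ := Gr.exists_apply_eq_mk a i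
    obtain ⟨z, hz, ez⟩ := Gr.exists_apply_eq_mk b i
    rw [map_add, DirectSum.add_apply, ha y hy ey, hb z hz ez, GrPiece.mk_add, GrPiece.mk_eq_mk]
    rw [DirectSum.add_apply, ey, ez, GrPiece.mk_add, GrPiece.mk_eq_mk] at e
    rw [← map_add, ← map_sub]
    exact hf _ _ e

variable [I.IsTwoSided]

theorem Gr.cls_mul {i j : ℕ} {x y : A} (hx : x ∈ I ^ i) (hy : y ∈ I ^ j) :
    Gr.cls I i x hx * Gr.cls I j y hy = Gr.cls I (i + j) (x * y) (mul_mem_pow_add hx hy) := by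
  rw [Gr.cls, Gr.cls, DirectSum.of_mul_of]
  rfl

theorem Gr.cls_zero_mul (s : A) {i : ℕ} {x : A} (hx : x ∈ I ^ i) :
    Gr.cls I 0 s (mem_pow_zero s) * Gr.cls I i x hx =
      Gr.cls I i (s * x) (Ideal.mul_mem_left _ s hx) := by
  rw [Gr.cls_mul]
  exact DirectSum.of_eq_of_gradedMonoid_eq (GrPiece.sigma_ext (zero_add i) _ _ rfl)

theorem Gr.cls_mul_zero (s : A) {i : ℕ} {x : A} (hx : x ∈ I ^ i) :
    Gr.cls I i x hx * Gr.cls I 0 s (mem_pow_zero s) =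
      Gr.cls I i (x * s) (Ideal.mul_mem_right s _ hx) := by
  rw [Gr.cls_mul]
  exact DirectSum.of_eq_of_gradedMonoid_eq (GrPiece.sigma_ext (add_zero i) _ _ rfl)

theorem Gr.mul_cls_zero_apply (s : A) {a : Gr I} {i : ℕ} {x : A} {hx : x ∈ I ^ i}
    (e : a i = GrPiece.mk x hx) :
    (a * Gr.cls I 0 s (mem_pow_zero s)) i = GrPiece.mk (x * s) (Ideal.mul_mem_right s _ hx) :=
  Gr.apply_eq_mk_map (AddMonoidHom.mulRight (Gr.cls I 0 s (mem_pow_zero s)))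
    (AddMonoidHom.mulRight s) (fun _ _ h => Ideal.mul_mem_right s _ h)
    (fun _ _ h => Gr.cls_mul_zero s h) a i x hx e

theorem Gr.exists_map {B : Type u} [Ring B] {J : Ideal B} [J.IsTwoSided] (f : A →+* B)
    (hf : ∀ i x, x ∈ I ^ i → f x ∈ J ^ i) :
    ∃ F : Gr I →+* Gr J, ∀ i x hx, F (Gr.cls I i x hx) = Gr.cls J i (f x) (hf i x hx) := by
  let g (i : ℕ) : GrPiece I i →+ Gr J := GrPiece.lift
    { toFun := fun x => Gr.cls J i (f x) (hf i x x.2)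
      map_zero' := Gr.cls_eq_zero (by simp) _
      map_add' := fun x y => by
        rw [← Gr.cls_add]; congr 1; exact map_add f _ _ }
    fun x hx => Gr.cls_eq_zero (hf _ _ hx) _
  have hg : ∀ i x hx, g i (GrPiece.mk x hx) = Gr.cls J i (f x) (hf i x hx) := fun _ _ _ => rfl
  refine ⟨DirectSum.toSemiring g ?_ ?_, fun i x hx => ?_⟩
  · refine (hg 0 1 (mem_pow_zero 1)).trans ?_
    have h1 : f 1 = 1 := map_one f
    simp only [h1]
    rfl
  · intro i j a b
    induction a using GrPiece.ind with | _ x hx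
    induction b using GrPiece.ind with | _ y hy
    refine (hg (i + j) (x * y) (mul_mem_pow_add hx hy)).trans ?_
    rw [hg, hg, Gr.cls_mul]
    simp only [map_mul]
  · exact DirectSum.toAddMonoid_of g i _

theorem Gr.isNoetherianRing [IsNoetherianRing A] {k : ℕ} (hk : I ^ k = ⊥) :
    IsNoetherianRing (Gr I) := by
  let := Module.compHom (Gr I) ((Gr.degZero I).comp (Ideal.Quotient.mk I))
  have hsmul : ∀ (r : A) (a : Gr I), r • a = Gr.cls I 0 r (mem_pow_zero r) * a := fun _ _ => rfl
  have : IsScalarTower A (Gr I) (Gr I) := ⟨fun r a b => by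
    rw [hsmul, hsmul, smul_eq_mul, smul_eq_mul, mul_assoc]⟩
  let g (i : ℕ) : ↥(I ^ i) →ₗ[A] Gr I :=
    { toFun := fun x => Gr.cls I i x x.2
      map_add' := fun x y => Gr.cls_add x.2 y.2
      map_smul' := fun r x => by
        rw [RingHom.id_apply, hsmul, Gr.cls_zero_mul]; rfl }
  have hle : (⨆ i : Fin k, LinearMap.range (g i)) = ⊤ := by
    refine eq_top_iff.2 fun a _ => ?_
    refine Gr.mem_of_cls_mem (⨆ i : Fin k, LinearMap.range (g i)).toAddSubmonoid a
      fun i x hx _ => ?_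
    by_cases hi : i < k
    · exact Submodule.mem_iSup_of_mem (⟨i, hi⟩ : Fin k) ⟨⟨x, hx⟩, rfl⟩
    · have h0 : x ∈ I ^ k := Ideal.pow_le_pow_right (not_lt.1 hi) hx
      rw [hk, Ideal.mem_bot] at h0
      subst h0
      rw [Gr.cls_eq_zero (zero_mem _)]
      exact zero_mem _
  have : IsNoetherian A (Gr I) := by
    rw [← isNoetherian_top_iff, ← hle]
    infer_instance
  -- Every left ideal of the graded ring is an A-submodule.
  exact isNoetherian_of_tower A this

end AssociatedGraded

/-! ### The localization of gr R at 𝒞̃, and the passage back to Q. -/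

section Localization

variable {R : Type u} [Ring R]

theorem mem_cTildeGr {z : Gr (primeRadical R)} :
    z ∈ cTildeGr R ↔ ∃ s ∈ R⁰, z = Gr.cls (primeRadical R) 0 s (mem_pow_zero s) := by
  constructor
  · rintro ⟨_, ⟨s, hs, rfl⟩, rfl⟩
    exact ⟨s, hs, rfl⟩
  · rintro ⟨s, hs, rfl⟩
    exact ⟨_, ⟨s, hs, rfl⟩, rfl⟩

theorem cls_zero_mem_cTildeGr {s : R} (hs : s ∈ R⁰) :
    Gr.cls (primeRadical R) 0 s (mem_pow_zero s) ∈ cTildeGr R :=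
  mem_cTildeGr.2 ⟨s, hs, rfl⟩

theorem HasLeftQuotientRing.hasCommonLeftMultiples_cTildeGr (hC : HasLeftQuotientRing R) :
    HasCommonLeftMultiples (cTildeGr R) := by
  intro a ha b hb
  obtain ⟨s, hs, rfl⟩ := mem_cTildeGr.1 ha
  obtain ⟨t, ht, rfl⟩ := mem_cTildeGr.1 hb
  obtain ⟨u, hu, r, e⟩ := hC.ore s t ht
  refine ⟨_, cls_zero_mem_cTildeGr hu, Gr.cls (primeRadical R) 0 r (mem_pow_zero r), ?_⟩
  rw [Gr.cls_zero_mul, Gr.cls_zero_mul]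
  simp only [e]

/-- Common left multiples merge the annihilators of the finitely many components into one: the
saturation of 0 is closed under addition. -/
theorem HasLeftQuotientRing.exists_mul_eq_zero (hC : HasLeftQuotientRing R)
    {a : Gr (primeRadical R)}
    (h : ∀ i x hx, a i = GrPiece.mk x hx → ∃ u ∈ R⁰, u * x ∈ primeRadical R ^ (i + 1)) :
    ∃ t ∈ cTildeGr R, t * a = 0 := by
  have : a ∈ hC.hasCommonLeftMultiples_cTildeGr.saturation ⊥ := by
    refine Gr.mem_of_cls_mem _ a fun i x hx e => ?_
    obtain ⟨u, hu, hx'⟩ := h i x hx e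
    refine ⟨_, cls_zero_mem_cTildeGr hu, ?_⟩
    rw [Gr.cls_zero_mul, Ideal.mem_bot]
    exact Gr.cls_eq_zero hx' _
  simpa [HasCommonLeftMultiples.mem_saturation] using this

theorem HasLeftQuotientRing.isLeftDenominatorSet_cTildeGr (hC : HasLeftQuotientRing R)
    [IsNoetherianRing hC.Q] : IsLeftDenominatorSet (cTildeGr R) where
  zero_notMem h0 := by
    obtain ⟨s, hs, e⟩ := mem_cTildeGr.1 h0
    have h1 : (0 : Gr (primeRadical R)) 0 = GrPiece.mk s (mem_pow_zero s) := by
      rw [e, Gr.cls_apply_self]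
    have h2 : s ∈ primeRadical R := by
      have := (GrPiece.mk_eq_zero _).1 h1.symm
      rwa [zero_add, Submodule.pow_one] at this
    -- A regular s in 𝔫 would have a regular power equal to 0.
    obtain ⟨k, hk⟩ := hC.exists_primeRadical_pow_eq_bot
    have h3 : ∀ i, s ^ i ∈ primeRadical R ^ i := by
      intro i
      induction i with
      | zero => exact mem_pow_zero _
      | succ i ih => rw [pow_succ, Submodule.pow_succ]; exact Ideal.mul_mem_mul ih h2
    have h4 := h3 k
    rw [hk, Ideal.mem_bot] at h4
    exact hC.zero_notMem (h4 ▸ pow_mem hs k)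
  ore a z hz := by
    obtain ⟨s, hs, rfl⟩ := mem_cTildeGr.1 hz
    have : a ∈ hC.hasCommonLeftMultiples_cTildeGr.saturation
        (Ideal.span {Gr.cls (primeRadical R) 0 s (mem_pow_zero s)}) := by
      refine Gr.mem_of_cls_mem _ a fun i x hx _ => ?_
      obtain ⟨t, ht, q, e⟩ := hC.ore x s hs
      -- The Ore condition of R gives q without control of its degree; the multiplier u brings it
      -- into 𝔫^i.
      obtain ⟨u, hu, hq⟩ := hC.mem_primeRadical_pow_of_mul_right (x := q) (i := i) hs
        (e ▸ Ideal.mul_mem_left _ _ hx)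
      refine ⟨_, cls_zero_mem_cTildeGr (mul_mem hu ht), Ideal.mem_span_singleton'.2
        ⟨Gr.cls _ i (u * q) hq, ?_⟩⟩
      rw [Gr.cls_zero_mul, Gr.cls_mul_zero]
      simp only [mul_assoc, e]
    obtain ⟨t, ht, h⟩ := this
    obtain ⟨q, hq⟩ := Ideal.mem_span_singleton'.1 h
    exact ⟨t, ht, q, hq.symm⟩
  reversible a z hz haz := by
    obtain ⟨s, hs, rfl⟩ := mem_cTildeGr.1 hz
    refine hC.exists_mul_eq_zero fun i x hx e => ?_
    have h1 := Gr.mul_cls_zero_apply s e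
    rw [haz] at h1
    exact hC.mem_primeRadical_pow_of_mul_right hs ((GrPiece.mk_eq_zero _).1 h1.symm)

theorem HasLeftQuotientRing.exists_loc_cTildeGr_ringEquiv (hC : HasLeftQuotientRing R)
    [IsNoetherianRing hC.Q] (hD : IsLeftDenominatorSet (cTildeGr R)) :
    ∃ φ : hD.Loc ≃+* Gr (primeRadical hC.Q),
      ∀ (i : ℕ) (x : R) (hx : x ∈ primeRadical R ^ i),
        φ (hD.toLoc (Gr.cls (primeRadical R) i x hx)) =
          Gr.cls (primeRadical hC.Q) i (hC.σ x) (hC.σ_mem_pow hx) := by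
  obtain ⟨F, hF⟩ := Gr.exists_map (I := primeRadical R) (J := primeRadical hC.Q) hC.σ
    fun i x hx => hC.σ_mem_pow hx
  have hunit : ∀ s ∈ R⁰, IsUnit (Gr.cls (primeRadical hC.Q) 0 (hC.σ s) (mem_pow_zero _)) := by
    intro s hs
    obtain ⟨v, h1, h2⟩ := (hC.isLeftDenominatorSet le_rfl).toLoc_mul_cancel hs
    have : IsUnit (hC.σ s) := ⟨⟨hC.σ s, v, h2, h1⟩, rfl⟩
    exact this.map ((Gr.degZero (primeRadical hC.Q)).comp (Ideal.Quotient.mk _))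
  obtain ⟨φ, hφ⟩ := hD.exists_lift F fun z hz => by
    obtain ⟨s, hs, rfl⟩ := mem_cTildeGr.1 hz
    rw [hF]
    exact hunit s hs
  have hinj : Function.Injective φ := by
    rw [injective_iff_map_eq_zero]
    intro q hq
    obtain ⟨s, hs, a, e⟩ := hD.exists_mul_eq_toLoc q
    have hFa : F a = 0 := by rw [← hφ, ← e, map_mul, hq, mul_zero]
    have ha : hD.toLoc a = 0 := by
      rw [hD.toLoc_eq_zero]
      refine hC.exists_mul_eq_zero fun i x hx ex => ?_
      have h1 := Gr.apply_eq_mk_map (F : _ →+ _) (hC.σ : R →+ hC.Q)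
        (fun i x hx => hC.σ_mem_pow hx) hF a i x hx ex
      replace h1 : F a i = GrPiece.mk (hC.σ x) (hC.σ_mem_pow hx) := h1
      rw [hFa] at h1
      exact hC.σ_mem_primeRadical_pow.1 ((GrPiece.mk_eq_zero _).1 h1.symm)
    exact hD.toLoc_cancel hs (by rw [e, ha, mul_zero])
  have hsurj : Function.Surjective φ := by
    intro a
    refine Gr.mem_of_cls_mem (AddMonoidHom.mrange (φ : hD.Loc →+ Gr (primeRadical hC.Q))) a
      fun i q hq _ => ?_
    obtain ⟨s, hs, x, hx, e⟩ := hC.mem_primeRadical_pow.1 hq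
    obtain ⟨v, -, hv⟩ := hD.toLoc_mul_cancel (cls_zero_mem_cTildeGr hs)
    -- The symbol of q = s⁻¹x is the image of the fraction of symbols; the two are compared after
    -- multiplication by the unit symbol of s.
    refine ⟨v * hD.toLoc (Gr.cls (primeRadical R) i x hx), (hunit s hs).mul_left_cancel ?_⟩
    have h1 := congrArg φ hv
    rw [map_mul, hφ, hF, map_one] at h1
    change _ * φ _ = _
    rw [map_mul, ← mul_assoc, h1, one_mul, hφ, hF, Gr.cls_zero_mul]
    simp only [e]
  exact ⟨RingEquiv.ofBijective φ ⟨hinj, hsurj⟩, fun i x hx => (hφ _).trans (hF i x hx)⟩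

/-- An equation t r = q s modulo 𝔫^i is improved to one modulo 𝔫^(i+1) by applying the Ore condition
of gr R to the symbol of the error t r - q s. -/
theorem hasLeftQuotientRing_of_isLeftDenominatorSet_cTildeGr
    (hD : IsLeftDenominatorSet (cTildeGr R)) {k : ℕ} (hk : primeRadical R ^ k = ⊥) :
    HasLeftQuotientRing R where
  zero_notMem h := hD.zero_notMem (mem_cTildeGr.2 ⟨0, h, (Gr.cls_eq_zero (zero_mem _) _).symm⟩)
  ore r s hs := by
    have key : ∀ i, ∃ t ∈ R⁰, ∃ q, t * r - q * s ∈ primeRadical R ^ i := by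
      intro i
      induction i with
      | zero => exact ⟨1, one_mem _, 0, mem_pow_zero _⟩
      | succ i ih =>
        obtain ⟨t, ht, q, hx⟩ := ih
        obtain ⟨z, hz, p, e⟩ := hD.ore (Gr.cls _ i _ hx) _ (cls_zero_mem_cTildeGr hs)
        obtain ⟨u, hu, rfl⟩ := mem_cTildeGr.1 hz
        obtain ⟨y, hy, ey⟩ := Gr.exists_apply_eq_mk p i
        have h1 := Gr.mul_cls_zero_apply s ey
        rw [← e, Gr.cls_zero_mul, Gr.cls_apply_self, GrPiece.mk_eq_mk] at h1
        -- The degree i component gives u(t r - q s) ≡ y s modulo 𝔫^(i+1).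
        refine ⟨u * t, mul_mem hu ht, u * q + y, ?_⟩
        convert h1 using 1
        noncomm_ring
    obtain ⟨t, ht, q, h⟩ := key k
    rw [hk, Ideal.mem_bot, sub_eq_zero] at h
    exact ⟨t, ht, q, h⟩

/-- The elements of the associated graded ring all of whose components are symbols of elements of
the left ideal `L`. -/
def symbolSubmonoid {A : Type u} [Ring A] (I L : Ideal A) : AddSubmonoid (Gr I) where
  carrier := {a | ∀ i, ∃ y, ∃ hy : y ∈ I ^ i, y ∈ L ∧ a i = GrPiece.mk y hy}
  zero_mem' := fun _ => ⟨0, zero_mem _, zero_mem _, rfl⟩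
  add_mem' := fun {a b} ha hb i => by
    obtain ⟨y, hy, hyL, e⟩ := ha i
    obtain ⟨z, hz, hzL, e'⟩ := hb i
    exact ⟨y + z, add_mem hy hz, add_mem hyL hzL, by rw [DirectSum.add_apply, e, e']; rfl⟩

theorem cls_mem_symbolSubmonoid {A : Type u} [Ring A] {I L : Ideal A} {i : ℕ} {y : A}
    (hy : y ∈ I ^ i) (hyL : y ∈ L) : Gr.cls I i y hy ∈ symbolSubmonoid I L := by
  intro j
  by_cases hij : j = i
  · subst hij
    exact ⟨y, hy, hyL, Gr.cls_apply_self hy⟩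
  · exact ⟨0, zero_mem _, zero_mem _, DirectSum.of_eq_of_ne _ _ _ hij⟩

/-- The left ideal of the associated graded ring whose homogeneous elements are the symbols of
the elements of the left ideal `L`. -/
def symbolIdeal {A : Type u} [Ring A] (I : Ideal A) [I.IsTwoSided] (L : Ideal A) :
    Ideal (Gr I) where
  toAddSubmonoid := symbolSubmonoid I L
  smul_mem' := fun c a ha => by
    change c * a ∈ symbolSubmonoid I L
    induction c using Gr.induction with
    | zero => rw [zero_mul]; exact zero_mem _
    | add c d hc hd => rw [add_mul]; exact add_mem hc hd
    | cls j r hr =>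
      refine Gr.mem_of_cls_mem
        ((symbolSubmonoid I L).comap (AddMonoidHom.mulLeft (Gr.cls I j r hr))) a
        fun i x hx e => ?_
      obtain ⟨y, hy, hyL, e'⟩ := ha i
      rw [AddSubmonoid.mem_comap]
      change Gr.cls I j r hr * Gr.cls I i x hx ∈ symbolSubmonoid I L
      -- The representative x of the component is exchanged for the representative y in L.
      rw [Gr.cls.eq_def I i, ← e, e', ← Gr.cls.eq_def I i y hy, Gr.cls_mul]
      exact cls_mem_symbolSubmonoid _ (L.mul_mem_left r hyL)

theorem symbolIdeal_mono {A : Type u} [Ring A] (I : Ideal A) [I.IsTwoSided] :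
    Monotone (symbolIdeal I) := fun _ _ h _ ha i =>
  let ⟨y, hy, hyL, e⟩ := ha i
  ⟨y, hy, h hyL, e⟩

theorem isNoetherianRing_Q_of_isNoetherianRing_loc (hC : HasLeftQuotientRing R)
    (hD : IsLeftDenominatorSet (cTildeGr R)) [IsNoetherianRing hD.Loc] {k : ℕ}
    (hk : primeRadical R ^ k = ⊥) : IsNoetherianRing hC.Q := by
  let Φ (L : Ideal hC.Q) : Ideal hD.Loc :=
    (symbolIdeal (primeRadical R) (L.comap hC.σ)).map hD.toLoc
  have hmono : Monotone Φ := fun L L' h =>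
    Ideal.map_mono (symbolIdeal_mono _ (Ideal.comap_mono h))
  have hcancel : ∀ (L : Ideal hC.Q) (s : R), s ∈ R⁰ → ∀ q, hC.σ s * q ∈ L → q ∈ L := by
    intro L s hs q hq
    obtain ⟨v, hv, -⟩ := (hC.isLeftDenominatorSet le_rfl).toLoc_mul_cancel hs
    rw [← one_mul q, ← hv, mul_assoc]
    exact L.mul_mem_left _ hq
  have hle : ∀ L L', L ≤ L' → Φ L' ≤ Φ L → L' ≤ L := by
    intro L L' hLL' h
    -- Descending induction on the degree i, starting from 𝔫^k = 0. Modulo 𝔫^(i+1), some u x agrees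
    -- with an element y of the contraction of L; the difference u x - y has higher degree and still
    -- lies in L', so u x ∈ L and u cancels in Q.
    have key : ∀ j i x, i + j = k → x ∈ primeRadical R ^ i → hC.σ x ∈ L' → hC.σ x ∈ L := by
      intro j
      induction j with
      | zero =>
        rintro i x rfl hx -
        rw [add_zero] at hk
        rw [hk, Ideal.mem_bot] at hx
        rw [hx, map_zero]
        exact zero_mem _
      | succ j ih =>
        intro i x hij hx hxL
        have h1 : hD.toLoc (Gr.cls _ i x hx) ∈ Φ L :=
          h (Ideal.mem_map_of_mem _ (cls_mem_symbolSubmonoid hx hxL))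
        obtain ⟨z, hz, h2⟩ := (hD.toLoc_mem_map _ _).1 h1
        obtain ⟨u, hu, rfl⟩ := mem_cTildeGr.1 hz
        obtain ⟨y, hy, hyL, e⟩ := h2 i
        rw [Gr.cls_zero_mul, Gr.cls_apply_self, GrPiece.mk_eq_mk] at e
        have h3 := ih (i + 1) _ (by omega) e (by
          rw [map_sub, map_mul]
          exact sub_mem (L'.mul_mem_left _ hxL) (hLL' hyL))
        refine hcancel L u hu _ ?_
        have := add_mem h3 hyL
        rwa [map_sub, sub_add_cancel, map_mul] at this
    intro q hq
    obtain ⟨s, hs, x, e⟩ := (hC.isLeftDenominatorSet le_rfl).exists_mul_eq_toLoc q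
    refine hcancel L s hs q ?_
    have h1 := L'.mul_mem_left (hC.σ s) hq
    rw [e] at h1 ⊢
    exact key k 0 x (zero_add k) (mem_pow_zero x) h1
  have hstrict : StrictMono Φ := fun L L' h =>
    lt_of_le_not_ge (hmono h.le) fun h' => h.not_ge (hle L L' h.le h')
  have : WellFoundedGT (Ideal hC.Q) := hstrict.wellFoundedGT
  exact isNoetherian_iff'.2 this

end Localization

end LeftQuot

theorem theorem1p3 (R : Type*) [Ring R] :
    ((∃ hC : LeftQuot.HasLeftQuotientRing R, IsNoetherianRing hC.Q) ↔
      ((∃ hD : LeftQuot.IsLeftDenominatorSet (LeftQuot.cTildeGr R), IsNoetherianRing hD.Loc) ∧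
        LeftQuot.cTilde R ≤ nonZeroDivisors (R ⧸ LeftQuot.primeRadical R) ∧
        ∃ k : ℕ, LeftQuot.primeRadical R ^ k = ⊥)) ∧
    ((∃ hC : LeftQuot.HasLeftQuotientRing R, IsNoetherianRing hC.Q) →
      ∃ (hC : LeftQuot.HasLeftQuotientRing R)
        (hD : LeftQuot.IsLeftDenominatorSet (LeftQuot.cTildeGr R)),
        (∃ φ : hD.Loc ≃+* LeftQuot.Gr (LeftQuot.primeRadical hC.Q),
          ∀ (i : ℕ) (x : R) (hx : x ∈ LeftQuot.primeRadical R ^ i),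
            ∃ hσ : hC.σ x ∈ LeftQuot.primeRadical hC.Q ^ i,
              φ (hD.toLoc (LeftQuot.Gr.cls (LeftQuot.primeRadical R) i x hx)) =
                LeftQuot.Gr.cls (LeftQuot.primeRadical hC.Q) i (hC.σ x) hσ) ∧
        IsNoetherianRing (LeftQuot.Gr (LeftQuot.primeRadical hC.Q))) := by
  refine ⟨⟨?_, ?_⟩, ?_⟩
  · rintro ⟨hC, _⟩
    have hD := hC.isLeftDenominatorSet_cTildeGr
    obtain ⟨φ, -⟩ := hC.exists_loc_cTildeGr_ringEquiv hD
    obtain ⟨k, hk⟩ := hC.exists_primeRadical_Q_pow_eq_bot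
    have := LeftQuot.Gr.isNoetherianRing hk
    -- The chain condition is carried from gr Q to the localization through φ.
    exact ⟨⟨hD, isNoetherianRing_of_ringEquiv _ φ.symm⟩, hC.cTilde_le,
      hC.exists_primeRadical_pow_eq_bot⟩
  · rintro ⟨⟨hD, _⟩, -, k, hk⟩
    have hC := LeftQuot.hasLeftQuotientRing_of_isLeftDenominatorSet_cTildeGr hD hk
    exact ⟨hC, LeftQuot.isNoetherianRing_Q_of_isNoetherianRing_loc hC hD hk⟩
  · rintro ⟨hC, _⟩
    have hD := hC.isLeftDenominatorSet_cTildeGr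
    obtain ⟨φ, hφ⟩ := hC.exists_loc_cTildeGr_ringEquiv hD
    obtain ⟨k, hk⟩ := hC.exists_primeRadical_Q_pow_eq_bot
    exact ⟨hC, hD, ⟨φ, fun i x hx => ⟨hC.σ_mem_pow hx, hφ i x hx⟩⟩,
      LeftQuot.Gr.isNoetherianRing hk⟩
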